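/- Setting. A finite set $V\subset\mathbb Z^2$ is identified with the grid graph it induces (two sites are adjacent iff they differ by one of the four unit directions $\mathcal D=\{(\pm1,0),(0,\pm1)\}$). A vertex of $V$ is \emph{pickable} if it has degree at most $1$, or has degree $2$ with its two neighbours on opposite sides of it. A vertex $v\in V$ may be \emph{knocked} in direction $d\in\mathcal D$ if $\{v+td: t\ge 1\}\cap V=\emptyset$. Picking or knocking $v$ deletes $v$. $\mathsf{Clean}(V)$ is the graph obtained by repeatedly deleting pickable vertices until none remains (it does not depend on the order), and $V$ is \emph{cleaned} if it has no pickable vertex. A \emph{complete knock-and-pick (KP) execution} from $V$ is a finite sequence of picks and knocks, each allowed in the graph in which it is performed, after which no vertex remains. A \emph{face} of $V$ is a fully occupied $2\times2$ square. A \emph{gadget} is a $2\times2$ square (one face), or a $3\times2$ or $2\times3$ rectangle (two adjacent faces), fully occupied in $V$. The \emph{candidate} vertices of a gadget are all four vertices of a square, and the two vertices of the middle row (resp. column) of a $3\times2$ (resp. $2\times3$) gadget. An \emph{exact cover} of $V$ is a set of gadgets of $V$ whose face sets are pairwise disjoint and have union the set of all faces of $V$. The \emph{face-adjacency graph} $\mathcal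 G_F$ of $V$ has the faces as vertices, a loop of weight $0$ at every face, and an edge of weight $1$ between two distinct faces whenever they are the two faces of a $3\times2$ or $2\times3$ gadget of $V$. A \emph{perfect matching} is a set of edges and loops such that every face is incident to exactly one of its elements. A matching corresponds to a set of gadgets: loops to square gadgets, the other edges to two-face gadgets. Theorem. Let $B\subset\mathbb Z^2$ be finite and $G^\circ=\mathsf{Clean}(B)$. The face-adjacency graph of $G^\circ$ has a maximum-weight perfect matching. Let $\mathcal C^\star$ be the set of gadgets corresponding to any such matching. Then $\mathcal C^\star$ is an exact cover of $G^\circ$ of minimum cardinality, and the following hold both for executions starting from $B$ and for executions starting from $G^\circ$. (i) The minimum number of knocks in a complete KP execution exists and equals $|\mathcal C^\star|$. (ii) There is a complete KP execution with exactly $|\mathcal C^\star|$ knocks that knocks the gadgets of $\mathcal C^\star$ one at a time: each knock is performed when no vertex is pickable, and deletes a candidate vertex of a gadget of $\mathcal C^\star$ that is fully occupied at that time; each gadget of $\mathcal C^\star$ is used for exactly one knock. -/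

import Mathlib

/-- A site `(i, j)` of the grid: `i` is the row and `j` the column. -/
abbrev Cell : Type := ℤ × ℤ

/-- The four axis directions. -/
def directions : Finset Cell := {(1, 0), (-1, 0), (0, 1), (0, -1)}

/-!
A grid graph is the subgraph of the square lattice induced by a finite set of sites, so it is
represented by its vertex set `V : Finset Cell`; two vertices are adjacent when they differ by one
of the four directions.
-/

/-- The neighbours of the site `v` in the grid graph with vertex set `V`. -/
def gridNeighbors (V : Finset Cell) (v : Cell) : Finset Cell :=
  V.filter (fun u => u - v ∈ directions)

/-- A vertex is pickable if it has degree at most one, or if it has degree two and its two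
neighbours are collinear with it. -/
def Pickable (V : Finset Cell) (v : Cell) : Prop :=
  v ∈ V ∧ ((gridNeighbors V v).card ≤ 1 ∨
    ((gridNeighbors V v).card = 2 ∧ ∃ d ∈ directions, gridNeighbors V v = {v + d, v - d}))

/-- The open ray of sites met when leaving `v` in direction `d`. -/
def ray (v d : Cell) : Set Cell := {p | ∃ t : ℕ, 1 ≤ t ∧ p = v + t • d}

/-- The vertex `v` can be knocked in direction `d`: the ray leaving `v` in that direction contains
no vertex. -/
def Knockable (V : Finset Cell) (v d : Cell) : Prop :=
  v ∈ V ∧ d ∈ directions ∧ ray v d ∩ (V : Set Cell) = ∅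

/-- A grid graph is cleaned if it has no pickable vertex. -/
def IsCleaned (V : Finset Cell) : Prop := ∀ v, ¬ Pickable V v

/-- `W` results from `V` by deleting one pickable vertex. -/
def PickStep (V W : Finset Cell) : Prop := ∃ v, Pickable V v ∧ W = V.erase v

/-- `W` results from `V` by repeatedly deleting pickable vertices until none remains. -/
def CleansTo (V W : Finset Cell) : Prop := Relation.ReflTransGen PickStep V W ∧ IsCleaned W

theorem Pickable.anti {V W : Finset Cell} {v : Cell} (h : Pickable V v) (hWV : W ⊆ V)
    (hv : v ∈ W) : Pickable W v := by
  have hsub : gridNeighbors W v ⊆ gridNeighbors V v := Finset.filter_subset_filter _ hWV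
  have hc := Finset.card_le_card hsub
  refine ⟨hv, ?_⟩
  rcases h.2 with h1 | ⟨h2, hd⟩
  · exact Or.inl (hc.trans h1)
  · by_cases h3 : (gridNeighbors W v).card ≤ 1
    · exact Or.inl h3
    · have h4 : gridNeighbors W v = gridNeighbors V v :=
        Finset.eq_of_subset_of_card_le hsub (by omega)
      exact Or.inr (h4 ▸ ⟨h2, hd⟩)

theorem exists_cleansTo (V : Finset Cell) : ∃ W, CleansTo V W := by
  induction V using Finset.strongInduction with
  | H V ih =>
    by_cases h : IsCleaned V
    · exact ⟨V, Relation.ReflTransGen.refl, h⟩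
    · simp only [IsCleaned, not_forall, not_not] at h
      obtain ⟨v, hv⟩ := h
      obtain ⟨W, hW, hW'⟩ := ih _ (Finset.erase_ssubset hv.1)
      exact ⟨W, Relation.ReflTransGen.head ⟨v, hv, rfl⟩ hW, hW'⟩

theorem CleansTo.subset {V W : Finset Cell} (h : Relation.ReflTransGen PickStep V W) : W ⊆ V := by
  induction h with
  | refl => exact subset_rfl
  | tail _ hs ih =>
    obtain ⟨v, _, rfl⟩ := hs
    exact (Finset.erase_subset _ _).trans ih

theorem IsCleaned.subset_of_pickSteps {V W U : Finset Cell} (hU : IsCleaned U) (hUV : U ⊆ V)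
    (h : Relation.ReflTransGen PickStep V W) : U ⊆ W := by
  induction h with
  | refl => exact hUV
  | tail _ hs ih =>
    obtain ⟨v, hv, rfl⟩ := hs
    exact Finset.subset_erase.2 ⟨ih, fun hvU => hU v (hv.anti ih hvU)⟩

/-- The result of exhaustive picking does not depend on the order of the picks. -/
theorem CleansTo.unique {V W W' : Finset Cell} (h : CleansTo V W) (h' : CleansTo V W') :
    W = W' :=
  subset_antisymm (h.2.subset_of_pickSteps (CleansTo.subset h.1) h'.1)
    (h'.2.subset_of_pickSteps (CleansTo.subset h'.1) h.1)

/-- The cleaned graph of `V`. -/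
noncomputable def clean (V : Finset Cell) : Finset Cell := (exists_cleansTo V).choose

theorem cleansTo_clean (V : Finset Cell) : CleansTo V (clean V) := (exists_cleansTo V).choose_spec

/-! ### Gadgets, faces and exact covers -/

/-- The three shapes of gadgets: `2 × 2`, `3 × 2` and `2 × 3` (rows × columns). -/
inductive GadgetShape : Type
  | square
  | vertical
  | horizontal
  deriving DecidableEq

/-- A gadget, given by its shape and its lexicographically least site. -/
structure Gadget : Type where
  shape : GadgetShape
  anchor : Cell
  deriving DecidableEq

namespace Gadget

/-- The sites of a gadget. -/
def cells : Gadget → Finset Cell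
  | ⟨.square, (i, j)⟩ => {(i, j), (i, j + 1), (i + 1, j), (i + 1, j + 1)}
  | ⟨.vertical, (i, j)⟩ =>
      {(i, j), (i, j + 1), (i + 1, j), (i + 1, j + 1), (i + 2, j), (i + 2, j + 1)}
  | ⟨.horizontal, (i, j)⟩ =>
      {(i, j), (i, j + 1), (i, j + 2), (i + 1, j), (i + 1, j + 1), (i + 1, j + 2)}

/-- The one or two unit faces covered by a gadget. -/
def faces : Gadget → Finset Cell
  | ⟨.square, (i, j)⟩ => {(i, j)}
  | ⟨.vertical, (i, j)⟩ => {(i, j), (i + 1, j)}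
  | ⟨.horizontal, (i, j)⟩ => {(i, j), (i, j + 1)}

/-- The knock-candidate vertices of a gadget: all corners of a square, and the two middle vertices
of a two-face gadget. -/
def cand : Gadget → Finset Cell
  | ⟨.square, (i, j)⟩ => {(i, j), (i, j + 1), (i + 1, j), (i + 1, j + 1)}
  | ⟨.vertical, (i, j)⟩ => {(i + 1, j), (i + 1, j + 1)}
  | ⟨.horizontal, (i, j)⟩ => {(i, j + 1), (i + 1, j + 1)}

/-- The edge (or loop) of the face-adjacency graph that corresponds to a gadget. -/
def edge : Gadget → Sym2 Cell
  | ⟨.square, (i, j)⟩ => s((i, j), (i, j))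
  | ⟨.vertical, (i, j)⟩ => s((i, j), (i + 1, j))
  | ⟨.horizontal, (i, j)⟩ => s((i, j), (i, j + 1))

theorem edge_injective : Function.Injective edge := by
  rintro ⟨s, i, j⟩ ⟨s', i', j'⟩ h
  cases s <;> cases s' <;> simp [edge] at h ⊢ <;> omega

/-- The gadget is fully occupied in the grid graph `V`. -/
def Present (V : Finset Cell) (g : Gadget) : Prop := g.cells ⊆ V

end Gadget

/-- The unit faces of a grid graph, each named by its least corner. -/
def unitFaces (V : Finset Cell) : Finset Cell :=
  V.filter (fun p => (p.1 + 1, p.2) ∈ V ∧ (p.1, p.2 + 1) ∈ V ∧ (p.1 + 1, p.2 + 1) ∈ V)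

/-- `C` is an exact cover of the faces of `V` by gadgets present in `V`. Distinct gadgets cover
distinct sets of faces, so `C` is the same as the corresponding family of face sets. -/
structure IsExactCover (V : Finset Cell) (C : Finset Gadget) : Prop where
  present : ∀ g ∈ C, g.Present V
  covers : C.biUnion Gadget.faces = unitFaces V
  disjoint : ∀ g ∈ C, ∀ g' ∈ C, g ≠ g' → Disjoint g.faces g'.faces

/-- `C` is an exact cover of the faces of `V` of minimum cardinality. -/
def IsMinExactCover (V : Finset Cell) (C : Finset Gadget) : Prop :=
  IsExactCover V C ∧ ∀ C', IsExactCover V C' → C.card ≤ C'.card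

/-! ### The face-adjacency graph and its perfect matchings -/

/-- The edges of the face-adjacency graph of `V`: a loop at every face, and an edge between any two
faces that share a grid edge and whose union is a `3 × 2` or `2 × 3` gadget present in `V`. -/
def faceGraphEdges (V : Finset Cell) : Set (Sym2 Cell) :=
  {e | (∃ f ∈ unitFaces V, e = s(f, f)) ∨
    ∃ f ∈ unitFaces V, ∃ f' ∈ unitFaces V, e = s(f, f') ∧
      ((f' = (f.1 + 1, f.2) ∧ Gadget.Present V ⟨.vertical, f⟩) ∨
        (f' = (f.1, f.2 + 1) ∧ Gadget.Present V ⟨.horizontal, f⟩))}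

/-- `M` is a perfect matching of the face-adjacency graph of `V`; loops are allowed. -/
def IsPerfectMatching (V : Finset Cell) (M : Finset (Sym2 Cell)) : Prop :=
  (M : Set (Sym2 Cell)) ⊆ faceGraphEdges V ∧ ∀ f ∈ unitFaces V, ∃! e, e ∈ M ∧ f ∈ e

/-- The weight of a set of edges: loops have weight `0`, all other edges weight `1`. -/
def matchingWeight (M : Finset (Sym2 Cell)) : ℕ := ∑ e ∈ M, if e.IsDiag then 0 else 1

/-- `M` is a perfect matching of the face-adjacency graph of `V` of maximum weight. -/
def IsMaxWeightPerfectMatching (V : Finset Cell) (M : Finset (Sym2 Cell)) : Prop :=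
  IsPerfectMatching V M ∧ ∀ M', IsPerfectMatching V M' → matchingWeight M' ≤ matchingWeight M

/-- The set of gadgets that corresponds to a set of edges of the face-adjacency graph: square
gadgets for the loops, two-face gadgets for the other edges. -/
noncomputable def gadgetsOfMatching (M : Finset (Sym2 Cell)) : Finset Gadget :=
  M.preimage Gadget.edge Gadget.edge_injective.injOn

/-! ### Knock-and-pick executions -/

/-- An action: pick the vertex `v`, or knock the vertex `v` in direction `d`. -/
inductive KPAction : Type
  | pick (v : Cell)
  | knock (v d : Cell)

namespace KPAction

/-- The vertex that the action removes. -/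
def vertex : KPAction → Cell
  | pick v => v
  | knock v _ => v

/-- The action can be performed in the grid graph `V`. -/
def Feasible (V : Finset Cell) : KPAction → Prop
  | pick v => Pickable V v
  | knock v d => Knockable V v d

/-- The action is a knock. -/
def isKnock : KPAction → Bool
  | pick _ => false
  | knock _ _ => true

end KPAction

/-- `π` is a complete feasible execution from `V`: every action is feasible in the graph in which
it is performed (picks pick pickable vertices, knocks have a clear ray), and no vertex remains at
the end. -/
def IsCompleteKPExecution : Finset Cell → List KPAction → Prop
  | V, [] => V = ∅
  | V, a :: π => a.Feasible V ∧ IsCompleteKPExecution (V.erase a.vertex) π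

/-- The number of knocks of an execution. -/
def numKnocks (π : List KPAction) : ℕ := π.countP KPAction.isKnock

/-- The execution `π` from `V` knocks the gadgets of `C` one at a time: every knock is performed
when picking is exhausted, it removes a knock-candidate vertex of a gadget of `C` that has not been
used before and that is present at that time, and at the end all gadgets of `C` have been used. -/
def KnocksAlong : Finset Cell → Finset Gadget → List KPAction → Prop
  | _, C, [] => C = ∅
  | V, C, .pick v :: π => KnocksAlong (V.erase v) C π
  | V, C, .knock v _ :: π => IsCleaned V ∧
      ∃ g ∈ C, g.Present V ∧ v ∈ g.cand ∧ KnocksAlong (V.erase v) (C.erase g) π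

/-!
Every exact cover of the faces of a grid graph, minimum or not, can be executed with one knock per
gadget, and every complete execution yields an exact cover with at most one gadget per knock. So the
minimum number of knocks is the minimum size of an exact cover.

A vertex is pickable exactly when it lacks a horizontal or a vertical neighbour (`pickable_iff`),
hence it is a corner of no face and picks leave the set of faces unchanged. The site in front of a
knocked vertex is empty, so the knock destroys no face, one face, or two adjacent ones, that is,
nothing or the faces of a gadget (`Knockable.unitFaces_erase`). Collecting these gadgets along an
execution gives the lower bound (`IsCompleteKPExecution.exists_isExactCover`).

For the upper bound it suffices to find, in a nonempty cleaned graph with an exact cover `C`, a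
knock at a candidate vertex of some gadget of `C` which destroys exactly the faces of this gadget
(`exists_servingKnock`); what remains is then exactly covered by the other gadgets. Start at the
leftmost vertex of the top row. As the graph is cleaned, this vertex is the upper left corner of a
face. If the gadget of `C` covering this face is a square, its corner can be knocked to the left; if
it is horizontal, its upper middle vertex can be knocked up. If it is vertical, its left middle
vertex can be knocked to the left unless the next row has a vertex further left; in that case the
argument repeats at the leftmost vertex of the next row (`IsStair.servingKnock_or_next`). This
staircase descends strictly to the left, so it ends.

Perfect matchings of the face-adjacency graph correspond to exact covers
(`isPerfectMatching_image_edge`), and the weight of the matching and the size of the cover add up to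
the number of faces, so maximum weight means minimum size.
-/

open Gadget

/-! ### Faces and their corners -/

theorem mem_unitFaces {V : Finset Cell} {i j : ℤ} : (i, j) ∈ unitFaces V ↔
    (i, j) ∈ V ∧ (i + 1, j) ∈ V ∧ (i, j + 1) ∈ V ∧ (i + 1, j + 1) ∈ V := by
  simp [unitFaces]

/-- The four corners of the unit face named `f`. -/
def faceCorners (f : Cell) : Finset Cell := Gadget.cells ⟨.square, f⟩

theorem mem_faceCorners {a b i j : ℤ} :
    (a, b) ∈ faceCorners (i, j) ↔ (a = i ∨ a = i + 1) ∧ (b = j ∨ b = j + 1) := by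
  simp [faceCorners, Gadget.cells]; omega

theorem mem_unitFaces_erase {V : Finset Cell} {v f : Cell} :
    f ∈ unitFaces (V.erase v) ↔ f ∈ unitFaces V ∧ v ∉ faceCorners f := by
  obtain ⟨i, j⟩ := f
  simp only [mem_unitFaces, Finset.mem_erase, faceCorners, Gadget.cells, Finset.mem_insert,
    Finset.mem_singleton, ne_eq, not_or, eq_comm (a := v)]
  tauto

theorem notMem_faceCorners {V : Finset Cell} {u f : Cell} (hf : f ∈ unitFaces V) (hu : u ∉ V) :
    u ∉ faceCorners f := by
  rw [← Finset.erase_eq_of_notMem hu] at hf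
  exact (mem_unitFaces_erase.1 hf).2

theorem Gadget.faces_nonempty (g : Gadget) : g.faces.Nonempty := by
  rcases g with ⟨_ | _ | _, i, j⟩ <;> simp [faces]

theorem Gadget.present_iff {V : Finset Cell} {g : Gadget} :
    g.Present V ↔ g.faces ⊆ unitFaces V := by
  rcases g with ⟨_ | _ | _, i, j⟩ <;>
    simp only [Present, cells, faces, Finset.insert_subset_iff, Finset.singleton_subset_iff,
      mem_unitFaces, add_assoc, one_add_one_eq_two] <;> tauto

/-! ### Picks and knocks -/

/-- A vertex is pickable exactly when it lacks a horizontal or a vertical neighbour. -/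
theorem pickable_iff {V : Finset Cell} {a b : ℤ} : Pickable V (a, b) ↔ (a, b) ∈ V ∧
    (((a + 1, b) ∉ V ∧ (a - 1, b) ∉ V) ∨ ((a, b + 1) ∉ V ∧ (a, b - 1) ∉ V)) := by
  have key : ∀ i j, (i, j) ∈ gridNeighbors V (a, b) ↔ (i, j) ∈ V ∧
      ((i = a + 1 ∧ j = b) ∨ (i = a - 1 ∧ j = b) ∨ (i = a ∧ j = b + 1) ∨ (i = a ∧ j = b - 1)) := by
    intro i j
    simp only [gridNeighbors, directions, Finset.mem_filter, Prod.mk_sub_mk, Finset.mem_insert,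
      Finset.mem_singleton, Prod.mk.injEq]
    refine and_congr_right fun _ => ?_
    omega
  refine and_congr_right fun _ => ⟨fun h => ?_, fun h => ?_⟩
  · by_contra hcon
    obtain ⟨x, hx, hxV⟩ : ∃ x, (x = a + 1 ∨ x = a - 1) ∧ (x, b) ∈ V := by
      by_contra! hx
      exact hcon (Or.inl ⟨hx _ (Or.inl rfl), hx _ (Or.inr rfl)⟩)
    obtain ⟨y, hy, hyV⟩ : ∃ y, (y = b + 1 ∨ y = b - 1) ∧ (a, y) ∈ V := by
      by_contra! hy
      exact hcon (Or.inr ⟨hy _ (Or.inl rfl), hy _ (Or.inr rfl)⟩)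
    have hxN : (x, b) ∈ gridNeighbors V (a, b) := (key _ _).2 ⟨hxV, by omega⟩
    have hyN : (a, y) ∈ gridNeighbors V (a, b) := (key _ _).2 ⟨hyV, by omega⟩
    rcases h with h | ⟨-, ⟨d1, d2⟩, -, h⟩
    · have := Finset.card_le_one.1 h _ hxN _ hyN
      simp only [Prod.mk.injEq] at this
      omega
    · rw [h] at hxN hyN
      simp only [Prod.mk_add_mk, Prod.mk_sub_mk, Finset.mem_insert, Finset.mem_singleton,
        Prod.mk.injEq] at hxN hyN
      omega
  · obtain ⟨d, hd, hsub⟩ : ∃ d ∈ directions,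
        gridNeighbors V (a, b) ⊆ {(a, b) + d, (a, b) - d} := by
      rcases h with h | h
      · refine ⟨(0, 1), by simp [directions], ?_⟩
        rintro ⟨i, j⟩ hij
        rw [key] at hij
        simp only [Prod.mk_add_mk, Prod.mk_sub_mk, Finset.mem_insert, Finset.mem_singleton,
          Prod.mk.injEq]
        rcases hij with ⟨hV, ⟨rfl, rfl⟩ | ⟨rfl, rfl⟩ | hij | hij⟩
        · exact absurd hV h.1
        · exact absurd hV h.2
        all_goals omega
      · refine ⟨(1, 0), by simp [directions], ?_⟩
        rintro ⟨i, j⟩ hij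
        rw [key] at hij
        simp only [Prod.mk_add_mk, Prod.mk_sub_mk, Finset.mem_insert, Finset.mem_singleton,
          Prod.mk.injEq]
        rcases hij with ⟨hV, hij | hij | ⟨rfl, rfl⟩ | ⟨rfl, rfl⟩⟩
        · omega
        · omega
        · exact absurd hV h.1
        · exact absurd hV h.2
    by_cases h1 : (gridNeighbors V (a, b)).card ≤ 1
    · exact Or.inl h1
    · have h2 := Finset.card_le_two (a := (a, b) + d) (b := (a, b) - d)
      have heq := Finset.eq_of_subset_of_card_le hsub (by omega)
      exact Or.inr ⟨le_antisymm (heq ▸ h2) (by omega), d, hd, heq⟩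

/-- A pickable vertex lies on no face, since a corner of a face has a horizontal and a vertical
neighbour. -/
theorem Pickable.unitFaces_erase {V : Finset Cell} {v : Cell} (h : Pickable V v) :
    unitFaces (V.erase v) = unitFaces V := by
  ext ⟨i, j⟩
  obtain ⟨a, b⟩ := v
  rw [mem_unitFaces_erase, and_iff_left_iff_imp, mem_unitFaces, mem_faceCorners]
  rw [pickable_iff] at h
  rintro ⟨h1, h2, h3, h4⟩ ⟨rfl | rfl, rfl | rfl⟩ <;> simp_all

theorem unitFaces_eq_of_pickSteps {V W : Finset Cell}
    (h : Relation.ReflTransGen PickStep V W) : unitFaces W = unitFaces V := by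
  induction h with
  | refl => rfl
  | tail _ hs ih =>
    obtain ⟨v, hv, rfl⟩ := hs
    exact hv.unitFaces_erase.trans ih

theorem unitFaces_clean (B : Finset Cell) : unitFaces (clean B) = unitFaces B :=
  unitFaces_eq_of_pickSteps (cleansTo_clean B).1

theorem Knockable.add_notMem {V : Finset Cell} {v d : Cell} (h : Knockable V v d) :
    v + d ∉ V := fun hV => by
  have : v + d ∈ ray v d ∩ (V : Set Cell) := ⟨⟨1, le_rfl, by simp⟩, hV⟩
  rw [h.2.2] at this
  exact this

theorem unitFaces_erase_eq_sdiff {V : Finset Cell} {v : Cell} {S : Finset Cell}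
    (h : ∀ f ∈ unitFaces V, v ∈ faceCorners f ↔ f ∈ S) :
    unitFaces (V.erase v) = unitFaces V \ S := by
  ext f
  rw [mem_unitFaces_erase, Finset.mem_sdiff]
  exact and_congr_right fun hf => not_congr (h f hf)

/-- If every face of `V` at `v` is one of the two faces of a gadget that both contain `v`, then
deleting `v` destroys no face or exactly the faces of a present gadget. -/
theorem unitFaces_erase_of_pair {V : Finset Cell} {v : Cell} (g : Gadget) (p q : Cell)
    (hg : g.faces = {p, q}) (hp : v ∈ faceCorners p) (hq : v ∈ faceCorners q)
    (h : ∀ f ∈ unitFaces V, v ∈ faceCorners f → f = p ∨ f = q) :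
    unitFaces (V.erase v) = unitFaces V ∨
      ∃ g : Gadget, g.Present V ∧ unitFaces (V.erase v) = unitFaces V \ g.faces := by
  have single : ∀ r, v ∈ faceCorners r → r ∈ unitFaces V →
      (∀ f ∈ unitFaces V, v ∈ faceCorners f → f = r) →
      ∃ g : Gadget, g.Present V ∧ unitFaces (V.erase v) = unitFaces V \ g.faces := by
    rintro r hr hrV hu
    have hf : Gadget.faces ⟨.square, r⟩ = {r} := by obtain ⟨i, j⟩ := r; rfl
    refine ⟨⟨.square, r⟩, present_iff.2 (by simpa [hf] using hrV),
      unitFaces_erase_eq_sdiff fun f hfV => ?_⟩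
    rw [hf, Finset.mem_singleton]
    exact ⟨hu f hfV, fun e => e ▸ hr⟩
  by_cases hpV : p ∈ unitFaces V <;> by_cases hqV : q ∈ unitFaces V
  · refine Or.inr ⟨g, present_iff.2 ?_, unitFaces_erase_eq_sdiff fun f hfV => ?_⟩
    · simp [hg, Finset.insert_subset_iff, hpV, hqV]
    · rw [hg, Finset.mem_insert, Finset.mem_singleton]
      exact ⟨h f hfV, by rintro (rfl | rfl) <;> assumption⟩
  · exact Or.inr (single p hp hpV fun f hf hv =>
      (h f hf hv).resolve_right fun e => hqV (e ▸ hf))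
  · exact Or.inr (single q hq hqV fun f hf hv =>
      (h f hf hv).resolve_left fun e => hpV (e ▸ hf))
  · refine Or.inl (Finset.ext fun f => ?_)
    rw [mem_unitFaces_erase, and_iff_left_iff_imp]
    intro hf hv
    rcases h f hf hv with rfl | rfl <;> contradiction

/-- A knock destroys no face or exactly the faces of a present gadget: the site in front of the
knocked vertex is empty, so only the two adjacent faces behind it can contain it. -/
theorem Knockable.unitFaces_erase {V : Finset Cell} {v d : Cell} (h : Knockable V v d) :
    unitFaces (V.erase v) = unitFaces V ∨
      ∃ g : Gadget, g.Present V ∧ unitFaces (V.erase v) = unitFaces V \ g.faces := by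
  have hn := h.add_notMem
  have hd := h.2.1
  obtain ⟨a, b⟩ := v
  simp only [directions, Finset.mem_insert, Finset.mem_singleton] at hd
  rcases hd with rfl | rfl | rfl | rfl
  · refine unitFaces_erase_of_pair ⟨.horizontal, (a - 1, b - 1)⟩ (a - 1, b - 1) (a - 1, b)
      (by simp [faces]) (by simp [mem_faceCorners]) (by simp [mem_faceCorners]) ?_
    rintro ⟨i, j⟩ hf hv
    have := notMem_faceCorners hf hn
    simp only [Prod.mk_add_mk, mem_faceCorners, Prod.mk.injEq] at this hv ⊢
    omega
  · refine unitFaces_erase_of_pair ⟨.horizontal, (a, b - 1)⟩ (a, b - 1) (a, b)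
      (by simp [faces]) (by simp [mem_faceCorners]) (by simp [mem_faceCorners]) ?_
    rintro ⟨i, j⟩ hf hv
    have := notMem_faceCorners hf hn
    simp only [Prod.mk_add_mk, mem_faceCorners, Prod.mk.injEq] at this hv ⊢
    omega
  · refine unitFaces_erase_of_pair ⟨.vertical, (a - 1, b - 1)⟩ (a - 1, b - 1) (a, b - 1)
      (by simp [faces]) (by simp [mem_faceCorners]) (by simp [mem_faceCorners]) ?_
    rintro ⟨i, j⟩ hf hv
    have := notMem_faceCorners hf hn
    simp only [Prod.mk_add_mk, mem_faceCorners, Prod.mk.injEq] at this hv ⊢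
    omega
  · refine unitFaces_erase_of_pair ⟨.vertical, (a - 1, b)⟩ (a - 1, b) (a, b)
      (by simp [faces]) (by simp [mem_faceCorners]) (by simp [mem_faceCorners]) ?_
    rintro ⟨i, j⟩ hf hv
    have := notMem_faceCorners hf hn
    simp only [Prod.mk_add_mk, mem_faceCorners, Prod.mk.injEq] at this hv ⊢
    omega

/-! ### Exact covers -/

/-- An exact cover depends on the faces of the grid graph only. -/
theorem IsExactCover.congr {V W : Finset Cell} {C : Finset Gadget} (h : IsExactCover V C)
    (hVW : unitFaces W = unitFaces V) : IsExactCover W C where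
  present g hg := present_iff.2 (hVW ▸ present_iff.1 (h.present g hg))
  covers := h.covers.trans hVW.symm
  disjoint := h.disjoint

theorem IsExactCover.faces_subset {V : Finset Cell} {C : Finset Gadget} (h : IsExactCover V C)
    {g : Gadget} (hg : g ∈ C) : g.faces ⊆ unitFaces V := present_iff.1 (h.present g hg)

theorem isExactCover_iff {V : Finset Cell} {C : Finset Gadget} : IsExactCover V C ↔
    (∀ g ∈ C, g.Present V) ∧ ∀ f ∈ unitFaces V, ∃! g, g ∈ C ∧ f ∈ g.faces := by
  constructor
  · intro h
    refine ⟨h.present, fun f hf => ?_⟩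
    rw [← h.covers, Finset.mem_biUnion] at hf
    obtain ⟨g, hg, hfg⟩ := hf
    refine ⟨g, ⟨hg, hfg⟩, fun g' hg' => ?_⟩
    by_contra hne
    exact Finset.disjoint_left.1 (h.disjoint _ hg'.1 _ hg hne) hg'.2 hfg
  · rintro ⟨hp, hu⟩
    refine ⟨hp, ?_, fun g hg g' hg' hne => Finset.disjoint_left.2 fun f hf hf' => ?_⟩
    · refine subset_antisymm (Finset.biUnion_subset.2 fun g hg => present_iff.1 (hp g hg)) ?_
      intro f hf
      obtain ⟨g, hg, -⟩ := hu f hf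
      exact Finset.mem_biUnion.2 ⟨g, hg⟩
    · exact hne ((hu f (present_iff.1 (hp g hg) hf)).unique ⟨hg, hf⟩ ⟨hg', hf'⟩)

theorem IsExactCover.erase {V W : Finset Cell} {C : Finset Gadget} {g : Gadget}
    (h : IsExactCover V C) (hg : g ∈ C) (hW : unitFaces W = unitFaces V \ g.faces) :
    IsExactCover W (C.erase g) := by
  obtain ⟨-, hu⟩ := isExactCover_iff.1 h
  refine isExactCover_iff.2 ⟨fun g' hg' => ?_, fun f hf => ?_⟩
  · rw [Finset.mem_erase] at hg'
    rw [present_iff, hW, Finset.subset_sdiff]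
    exact ⟨h.faces_subset hg'.2, h.disjoint _ hg'.2 _ hg hg'.1⟩
  · rw [hW, Finset.mem_sdiff] at hf
    obtain ⟨g', hg', hu'⟩ := hu f hf.1
    exact ⟨g', ⟨Finset.mem_erase.2 ⟨fun e => hf.2 (e ▸ hg'.2), hg'.1⟩, hg'.2⟩,
      fun k hk => hu' k ⟨Finset.mem_of_mem_erase hk.1, hk.2⟩⟩

theorem IsExactCover.insert {V W : Finset Cell} {C : Finset Gadget} {g : Gadget}
    (h : IsExactCover W C) (hg : g.Present V) (hW : unitFaces W = unitFaces V \ g.faces) :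
    IsExactCover V (insert g C) := by
  obtain ⟨-, hu⟩ := isExactCover_iff.1 h
  have hC : ∀ g' ∈ C, g'.faces ⊆ unitFaces V ∧ Disjoint g'.faces g.faces := fun g' hg' =>
    Finset.subset_sdiff.1 (hW ▸ h.faces_subset hg')
  refine isExactCover_iff.2 ⟨fun g' hg' => ?_, fun f hf => ?_⟩
  · rcases Finset.mem_insert.1 hg' with rfl | hg'
    · exact hg
    · exact present_iff.2 (hC g' hg').1
  · by_cases hfg : f ∈ g.faces
    · refine ⟨g, ⟨Finset.mem_insert_self _ _, hfg⟩, fun k hk => ?_⟩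
      refine (Finset.mem_insert.1 hk.1).resolve_right fun hkC => ?_
      exact Finset.disjoint_left.1 (hC k hkC).2 hk.2 hfg
    · obtain ⟨g', hg', hu'⟩ := hu f (hW ▸ Finset.mem_sdiff.2 ⟨hf, hfg⟩)
      refine ⟨g', ⟨Finset.mem_insert_of_mem hg'.1, hg'.2⟩, fun k hk => hu' k ⟨?_, hk.2⟩⟩
      exact (Finset.mem_insert.1 hk.1).resolve_left fun e => hfg (e ▸ hk.2)

theorem isExactCover_empty_iff {C : Finset Gadget} : IsExactCover ∅ C ↔ C = ∅ := by
  constructor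
  · intro h
    refine Finset.eq_empty_of_forall_notMem fun g hg => ?_
    obtain ⟨f, hf⟩ := g.faces_nonempty
    simpa [unitFaces] using h.faces_subset hg hf
  · rintro rfl
    exact ⟨by simp, by simp [unitFaces], by simp⟩

/-- The lower bound: the gadgets destroyed by the knocks of a complete execution form an exact
cover. -/
theorem IsCompleteKPExecution.exists_isExactCover {π : List KPAction} {V : Finset Cell}
    (h : IsCompleteKPExecution V π) : ∃ C, IsExactCover V C ∧ C.card ≤ numKnocks π := by
  induction π generalizing V with
  | nil =>
    obtain rfl : V = ∅ := h
    exact ⟨∅, isExactCover_empty_iff.2 rfl, by simp⟩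
  | cons a π ih =>
    obtain ⟨C, hC, hcard⟩ := ih h.2
    cases a with
    | pick v =>
      exact ⟨C, hC.congr (Pickable.unitFaces_erase h.1).symm, by
        simpa [numKnocks, KPAction.isKnock] using hcard⟩
    | knock v d =>
      have hk : numKnocks (.knock v d :: π) = numKnocks π + 1 := List.countP_cons_of_pos rfl
      rcases Knockable.unitFaces_erase h.1 with e | ⟨g, hg, e⟩
      · exact ⟨C, hC.congr e.symm, by omega⟩
      · exact ⟨_, hC.insert hg e, by have := Finset.card_insert_le g C; omega⟩

/-! ### Executing an exact cover -/

theorem knockable_left {V : Finset Cell} {a b : ℤ} (hV : (a, b) ∈ V)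
    (h : ∀ j, (a, j) ∈ V → b ≤ j) : Knockable V (a, b) (0, -1) := by
  refine ⟨hV, by simp [directions], Set.eq_empty_iff_forall_notMem.2 ?_⟩
  rintro _ ⟨⟨t, ht, rfl⟩, hp⟩
  have hp' : (a, b - t) ∈ V := by simpa [sub_eq_add_neg] using hp
  have := h _ hp'
  omega

theorem knockable_up {V : Finset Cell} {a b : ℤ} (hV : (a, b) ∈ V)
    (h : ∀ i < a, (i, b) ∉ V) : Knockable V (a, b) (-1, 0) := by
  refine ⟨hV, by simp [directions], Set.eq_empty_iff_forall_notMem.2 ?_⟩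
  rintro _ ⟨⟨t, ht, rfl⟩, hp⟩
  have hp' : (a - t, b) ∈ V := by simpa [sub_eq_add_neg] using hp
  exact h _ (by omega) hp'

theorem IsCleaned.neighbors {V : Finset Cell} (h : IsCleaned V) {a b : ℤ} (hV : (a, b) ∈ V) :
    ((a + 1, b) ∈ V ∨ (a - 1, b) ∈ V) ∧ ((a, b + 1) ∈ V ∨ (a, b - 1) ∈ V) := by
  have := h (a, b)
  rw [pickable_iff] at this
  tauto

/-- A knock that serves the gadget `g` of the cover: the knocked vertex is a candidate of `g`, and
the faces of `V` at this vertex are exactly the faces of `g`. -/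
def ServingKnock (V : Finset Cell) (g : Gadget) (v d : Cell) : Prop :=
  v ∈ g.cand ∧ Knockable V v d ∧ ∀ f ∈ unitFaces V, v ∈ faceCorners f ↔ f ∈ g.faces

/-- The site `(r, a)` is a step of the upper left staircase of `V`: the leftmost vertex of row `r`,
strictly to the left of all vertices of earlier rows, and such that the next column is empty above
row `r` unless the face above and to the right is the upper face of a vertical gadget of `C`. -/
structure IsStair (V : Finset Cell) (C : Finset Gadget) (r a : ℤ) : Prop where
  mem : (r, a) ∈ V
  row : ∀ j, (r, j) ∈ V → a ≤ j
  above : ∀ i j, (i, j) ∈ V → i < r → a < j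
  next : (∀ i < r, (i, a + 1) ∉ V) ∨ ⟨.vertical, (r - 1, a + 1)⟩ ∈ C

theorem exists_leftmost {V : Finset Cell} {r j : ℤ} (h : (r, j) ∈ V) :
    ∃ a ≤ j, (r, a) ∈ V ∧ ∀ k, (r, k) ∈ V → a ≤ k := by
  obtain ⟨⟨i, a⟩, hp, hmin⟩ := (V.filter fun p => p.1 = r).exists_min_image Prod.snd
    ⟨(r, j), by simp [h]⟩
  simp only [Finset.mem_filter] at hp hmin
  obtain ⟨hp, rfl⟩ := hp
  exact ⟨a, hmin (i, j) ⟨h, rfl⟩, hp, fun k hk => hmin (i, k) ⟨hk, rfl⟩⟩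

theorem exists_isStair {V : Finset Cell} (C : Finset Gadget) (h : V.Nonempty) :
    ∃ r a, IsStair V C r a := by
  obtain ⟨⟨r, j⟩, hp, hmin⟩ := V.exists_min_image Prod.fst h
  obtain ⟨a, -, ha, hrow⟩ := exists_leftmost hp
  have top : ∀ i j, (i, j) ∈ V → ¬ i < r := fun i j hij => not_lt.2 (hmin _ hij)
  exact ⟨r, a, ha, hrow, fun i j hij hi => absurd hi (top i j hij),
    Or.inl fun i hi hV => top _ _ hV hi⟩

/-- At a stair, either the gadget covering the corner face can be knocked, or it is vertical and
the staircase goes on strictly further left in the next row. -/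
theorem IsStair.servingKnock_or_next {V : Finset Cell} {C : Finset Gadget} {r a : ℤ}
    (hV : IsCleaned V) (hC : IsExactCover V C) (h : IsStair V C r a) :
    (∃ g ∈ C, ∃ v d, ServingKnock V g v d) ∨ ∃ a' < a, IsStair V C (r + 1) a' := by
  have hleft : (r, a - 1) ∉ V := fun hm => by have := h.row _ hm; omega
  have hup : ∀ j ≤ a, (r - 1, j) ∉ V := fun j hj hm => by
    have := h.above _ _ hm (by omega); omega
  have hdown : (r + 1, a) ∈ V := (hV.neighbors h.mem).1.resolve_right (hup a le_rfl)
  have hright : (r, a + 1) ∈ V := (hV.neighbors h.mem).2.resolve_right hleft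
  -- Either nothing is above `(r, a + 1)`, which then needs a lower neighbour because it is not
  -- pickable, or the site is a corner of the lower face of the preceding vertical gadget.
  have hdiag : (r + 1, a + 1) ∈ V := by
    rcases h.next with hn | hn
    · exact (hV.neighbors hright).1.resolve_right (hn _ (by omega))
    · exact hC.present _ hn (by simp [cells]; omega)
  have hface : (r, a) ∈ unitFaces V := mem_unitFaces.2 ⟨h.mem, hdown, hright, hdiag⟩
  obtain ⟨-, hu⟩ := isExactCover_iff.1 hC
  obtain ⟨g, ⟨hgC, hga⟩, -⟩ := hu _ hface
  have hgV := hC.faces_subset hgC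
  rcases g with ⟨_ | _ | _, x, y⟩
  · simp only [faces, Finset.mem_singleton, Prod.mk.injEq] at hga
    obtain ⟨rfl, rfl⟩ := hga
    -- A square is knocked at its corner `(r, a)`, which lies on no other face.
    refine Or.inl ⟨_, hgC, (r, a), _, by simp [cand], knockable_left h.mem h.row, ?_⟩
    rintro ⟨i, j⟩ hf
    have h1 := notMem_faceCorners hf hleft
    have h2 := notMem_faceCorners hf (hup a le_rfl)
    simp only [mem_faceCorners, faces, Finset.mem_singleton, Prod.mk.injEq] at h1 h2 ⊢
    omega
  · have hxy : x = r ∧ y = a := by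
      simp only [faces, Finset.mem_insert, Finset.mem_singleton, Prod.mk.injEq] at hga
      by_contra hne
      obtain ⟨rfl, rfl⟩ : x = r - 1 ∧ y = a := by omega
      exact hup _ le_rfl (mem_unitFaces.1 (hgV (by simp [faces]))).1
    obtain ⟨rfl, rfl⟩ := hxy
    obtain ⟨a', ha', hm, hrow⟩ := exists_leftmost hdown
    rcases ha'.eq_or_lt with rfl | hlt
    · -- The middle vertex on the left side can be knocked to the left.
      refine Or.inl ⟨_, hgC, (x + 1, a'), _, by simp [cand], knockable_left hm hrow, ?_⟩
      rintro ⟨i, j⟩ hf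
      have h1 := notMem_faceCorners hf (u := (x + 1, a' - 1)) fun h' => by
        have := hrow _ h'; omega
      simp only [mem_faceCorners, faces, Finset.mem_insert, Finset.mem_singleton,
        Prod.mk.injEq] at h1 ⊢
      omega
    · refine Or.inr ⟨a', hlt, hm, hrow, fun i j hij hi => ?_, ?_⟩
      · rcases (Int.lt_add_one_iff.1 hi).eq_or_lt with rfl | hi
        · exact hlt.trans_le (h.row _ hij)
        · exact hlt.trans (h.above _ _ hij hi)
      · by_cases e : a' + 1 = y
        · exact Or.inr (by simpa [e] using hgC)
        · refine Or.inl fun i hi hij => ?_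
          rcases (Int.lt_add_one_iff.1 hi).eq_or_lt with rfl | hi
          · have := h.row _ hij; omega
          · have := h.above _ _ hij hi; omega
  · have hxy : x = r ∧ y = a := by
      simp only [faces, Finset.mem_insert, Finset.mem_singleton, Prod.mk.injEq] at hga
      by_contra hne
      obtain ⟨rfl, rfl⟩ : x = r ∧ y = a - 1 := by omega
      exact hleft (mem_unitFaces.1 (hgV (by simp [faces]))).1
    obtain ⟨rfl, rfl⟩ := hxy
    -- The column of the middle vertices is empty above: otherwise the face to the right of the
    -- corner face would also be covered by the vertical gadget of the preceding stair.
    have hn : ∀ i < x, (i, y + 1) ∉ V := h.next.resolve_right fun hv => by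
      have hd := hC.disjoint _ hv _ hgC (by simp)
      simp [faces] at hd
    refine Or.inl ⟨_, hgC, (x, y + 1), _, by simp [cand], knockable_up hright hn, ?_⟩
    rintro ⟨i, j⟩ hf
    have h1 := notMem_faceCorners hf (hn (x - 1) (by omega))
    simp only [mem_faceCorners, faces, Finset.mem_insert, Finset.mem_singleton,
      Prod.mk.injEq] at h1 ⊢
    omega

theorem exists_servingKnock {V : Finset Cell} {C : Finset Gadget} (hV : IsCleaned V)
    (hne : V.Nonempty) (hC : IsExactCover V C) : ∃ g ∈ C, ∃ v d, ServingKnock V g v d := by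
  classical
  obtain ⟨r, a, h⟩ := exists_isStair C hne
  obtain ⟨⟨r, a⟩, hp, hmin⟩ := (V.filter fun p => IsStair V C p.1 p.2).exists_min_image Prod.snd
    ⟨(r, a), by simp [h, h.mem]⟩
  simp only [Finset.mem_filter] at hp hmin
  refine (hp.2.servingKnock_or_next hV hC).resolve_right ?_
  rintro ⟨a', hlt, h'⟩
  exact absurd (hmin _ ⟨h'.mem, h'⟩) (not_le.2 hlt)

/-- The upper bound: every exact cover, minimum or not, can be executed gadget by gadget. -/
theorem IsExactCover.exists_execution {V : Finset Cell} {C : Finset Gadget}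
    (hC : IsExactCover V C) :
    ∃ π, IsCompleteKPExecution V π ∧ numKnocks π = C.card ∧ KnocksAlong V C π := by
  induction V using Finset.strongInduction generalizing C with
  | H V ih =>
    rcases V.eq_empty_or_nonempty with rfl | hne
    · obtain rfl := isExactCover_empty_iff.1 hC
      exact ⟨[], rfl, rfl, rfl⟩
    by_cases hV : IsCleaned V
    · obtain ⟨g, hg, v, d, hv, hk, hf⟩ := exists_servingKnock hV hne hC
      obtain ⟨π, h1, h2, h3⟩ := ih _ (Finset.erase_ssubset hk.1)
        (hC.erase hg (unitFaces_erase_eq_sdiff hf))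
      refine ⟨.knock v d :: π, ⟨hk, h1⟩, ?_, hV, g, hg, hC.present g hg, hv, h3⟩
      rw [← Finset.card_erase_add_one hg, ← h2]
      exact List.countP_cons_of_pos rfl
    · simp only [IsCleaned, not_forall, not_not] at hV
      obtain ⟨v, hv⟩ := hV
      obtain ⟨π, h1, h2, h3⟩ := ih _ (Finset.erase_ssubset hv.1) (hC.congr hv.unitFaces_erase)
      exact ⟨.pick v :: π, ⟨hv, h1⟩, by simpa [numKnocks, KPAction.isKnock] using h2, h3⟩

/-! ### Exact covers and perfect matchings -/

theorem Gadget.mem_edge {g : Gadget} {f : Cell} : f ∈ g.edge ↔ f ∈ g.faces := by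
  rcases g with ⟨_ | _ | _, i, j⟩ <;> simp [edge, faces]

theorem Gadget.edge_mem_faceGraphEdges {V : Finset Cell} {g : Gadget} :
    g.edge ∈ faceGraphEdges V ↔ g.Present V := by
  constructor
  · rintro (⟨f, hf, e⟩ | ⟨f, hf, f', hf', e, ⟨rfl, hp⟩ | ⟨rfl, hp⟩⟩)
    · obtain rfl : g = ⟨.square, f⟩ := edge_injective e
      exact present_iff.2 (Finset.singleton_subset_iff.2 hf)
    · obtain rfl : g = ⟨.vertical, f⟩ := edge_injective e
      exact hp
    · obtain rfl : g = ⟨.horizontal, f⟩ := edge_injective e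
      exact hp
  · intro hp
    have hf := present_iff.1 hp
    rcases g with ⟨_ | _ | _, i, j⟩
    · exact Or.inl ⟨_, hf (by simp [faces]), rfl⟩
    · exact Or.inr ⟨(i, j), hf (by simp [faces]), _, hf (by simp [faces]), rfl,
        Or.inl ⟨rfl, hp⟩⟩
    · exact Or.inr ⟨(i, j), hf (by simp [faces]), _, hf (by simp [faces]), rfl,
        Or.inr ⟨rfl, hp⟩⟩

theorem exists_gadget_of_mem_faceGraphEdges {V : Finset Cell} {e : Sym2 Cell}
    (he : e ∈ faceGraphEdges V) : ∃ g : Gadget, g.edge = e := by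
  rcases he with ⟨⟨i, j⟩, -, rfl⟩ | ⟨⟨i, j⟩, -, f', -, rfl, ⟨rfl, -⟩ | ⟨rfl, -⟩⟩
  · exact ⟨⟨.square, (i, j)⟩, rfl⟩
  · exact ⟨⟨.vertical, (i, j)⟩, rfl⟩
  · exact ⟨⟨.horizontal, (i, j)⟩, rfl⟩

theorem isPerfectMatching_image_edge {V : Finset Cell} {C : Finset Gadget} :
    IsPerfectMatching V (C.image edge) ↔ IsExactCover V C := by
  rw [isExactCover_iff, IsPerfectMatching]
  refine and_congr ?_ (forall₂_congr fun f _ => ?_)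
  · simp [Set.subset_def, edge_mem_faceGraphEdges]
  · constructor
    · rintro ⟨e, ⟨he, hfe⟩, hu⟩
      obtain ⟨g, hg, rfl⟩ := Finset.mem_image.1 he
      exact ⟨g, ⟨hg, mem_edge.1 hfe⟩, fun k hk => edge_injective
        (hu _ ⟨Finset.mem_image_of_mem _ hk.1, mem_edge.2 hk.2⟩)⟩
    · rintro ⟨g, ⟨hg, hfg⟩, hu⟩
      refine ⟨g.edge, ⟨Finset.mem_image_of_mem _ hg, mem_edge.2 hfg⟩, ?_⟩
      rintro e ⟨he, hfe⟩
      obtain ⟨k, hk, rfl⟩ := Finset.mem_image.1 he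
      rw [hu k ⟨hk, mem_edge.1 hfe⟩]

theorem IsPerfectMatching.image_gadgetsOfMatching {V : Finset Cell} {M : Finset (Sym2 Cell)}
    (h : IsPerfectMatching V M) : (gadgetsOfMatching M).image edge = M := by
  classical
  rw [gadgetsOfMatching, Finset.image_preimage, Finset.filter_true_of_mem]
  exact fun e he => exists_gadget_of_mem_faceGraphEdges (h.1 he)

/-- A gadget has one face more than the weight of its edge, so the cardinality of an exact cover
and the weight of its matching add up to the number of faces. -/
theorem IsExactCover.card_add_matchingWeight {V : Finset Cell} {C : Finset Gadget}
    (h : IsExactCover V C) :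
    C.card + matchingWeight (C.image edge) = (unitFaces V).card := by
  rw [← h.covers, Finset.card_biUnion h.disjoint, matchingWeight,
    Finset.sum_image edge_injective.injOn, Finset.card_eq_sum_ones, ← Finset.sum_add_distrib]
  refine Finset.sum_congr rfl fun g _ => ?_
  rcases g with ⟨_ | _ | _, i, j⟩ <;> simp [edge, faces]

theorem exists_isExactCover (V : Finset Cell) : ∃ C, IsExactCover V C := by
  have hf : ∀ f, Gadget.faces ⟨.square, f⟩ = {f} := fun ⟨_, _⟩ => rfl
  refine ⟨(unitFaces V).image (Gadget.mk .square), ⟨?_, ?_, ?_⟩⟩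
  · simp only [Finset.mem_image]
    rintro _ ⟨f, hfV, rfl⟩
    rw [present_iff, hf, Finset.singleton_subset_iff]
    exact hfV
  · ext f
    simp only [Finset.image_biUnion, hf, Finset.biUnion_singleton_eq_self]
  · simp only [Finset.mem_image]
    rintro _ ⟨f, -, rfl⟩ _ ⟨f', -, rfl⟩ hne
    simp only [hf, Finset.disjoint_singleton]
    rintro rfl
    exact hne rfl

theorem exists_isMaxWeightPerfectMatching (V : Finset Cell) :
    ∃ M, IsMaxWeightPerfectMatching V M := by
  obtain ⟨C, ⟨hC, hmin⟩⟩ : ∃ C, IsMinExactCover V C := by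
    classical
    obtain ⟨C, hC, hmin⟩ := WellFounded.has_min (measure (Finset.card (α := Gadget))).wf
      {C | IsExactCover V C} (exists_isExactCover V)
    exact ⟨C, hC, fun C' hC' => not_lt.1 (hmin C' hC')⟩
  refine ⟨C.image edge, isPerfectMatching_image_edge.2 hC, fun M' hM' => ?_⟩
  have hM := hM'
  rw [← hM'.image_gadgetsOfMatching, isPerfectMatching_image_edge] at hM
  have h1 := hM.card_add_matchingWeight
  rw [hM'.image_gadgetsOfMatching] at h1
  have h2 := hC.card_add_matchingWeight
  have h3 := hmin _ hM
  omega

theorem IsMaxWeightPerfectMatching.isMinExactCover {V : Finset Cell} {M : Finset (Sym2 Cell)}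
    (h : IsMaxWeightPerfectMatching V M) : IsMinExactCover V (gadgetsOfMatching M) := by
  have hM := h.1
  rw [← h.1.image_gadgetsOfMatching, isPerfectMatching_image_edge] at hM
  refine ⟨hM, fun C' hC' => ?_⟩
  have h1 := hM.card_add_matchingWeight
  rw [h.1.image_gadgetsOfMatching] at h1
  have h2 := hC'.card_add_matchingWeight
  have h3 := h.2 _ (isPerfectMatching_image_edge.2 hC')
  omega

theorem mainTheorem1 (B : Finset Cell) :
    (∃ M, IsMaxWeightPerfectMatching (clean B) M) ∧
    ∀ (M : Finset (Sym2 Cell)), IsMaxWeightPerfectMatching (clean B) M →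
      ∀ (C : Finset Gadget), C = gadgetsOfMatching M →
        IsMinExactCover (clean B) C ∧
        ∀ V₀ : Finset Cell, V₀ = B ∨ V₀ = clean B →
          IsLeast {k : ℕ | ∃ π, IsCompleteKPExecution V₀ π ∧ numKnocks π = k} C.card ∧
          ∃ π, IsCompleteKPExecution V₀ π ∧ numKnocks π = C.card ∧ KnocksAlong V₀ C π := by
  refine ⟨exists_isMaxWeightPerfectMatching _, ?_⟩
  rintro M hM C rfl
  have hmin := hM.isMinExactCover
  refine ⟨hmin, fun V₀ hV₀ => ?_⟩
  have hfaces : unitFaces V₀ = unitFaces (clean B) := by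
    rcases hV₀ with rfl | rfl
    · exact (unitFaces_clean _).symm
    · rfl
  obtain ⟨π, h1, h2, h3⟩ := (hmin.1.congr hfaces).exists_execution
  refine ⟨⟨⟨π, h1, h2⟩, ?_⟩, π, h1, h2, h3⟩
  rintro k ⟨π', hπ', rfl⟩
  obtain ⟨C', hC', hcard⟩ := hπ'.exists_isExactCover
  exact (hmin.2 C' (hC'.congr hfaces.symm)).trans hcard
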